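/- Let $G$ be a (real, finite-dimensional) Lie group, $V$ a finite-dimensional real vector space and $\Phi:G\to \mathrm{Aut}(V)$ a representation, i.e. a smooth group homomorphism. The tangent bundle $TG$ is a group under the tangent maps of the multiplication and inversion of $G$ (with $T(G\times G)\cong TG\times TG$). The tangent bundle $TV$ is a real vector space under $$X\oplus Y=(T\tau_y)X+(T\tau_x)Y,\qquad \lambda\bullet X=(T\sigma_\lambda)X\qquad (X\in T_xV,\ Y\in T_yV,\ \lambda\in\mathbb R),$$ where $\tau_x$ is translation by $x$ and $\sigma_\lambda$ is multiplication by $\lambda$; the trivialization $\psi:TV\to V\times V$ is a linear isomorphism. The prolongation of $\Phi$ is the representation $\widetilde\Phi:TG\to\mathrm{Aut}(TV)$ given, for $X_a\in T_aG$ and in the trivialization $\psi$, by $$\widetilde\Phi(X_a)=\begin{pmatrix}\Phi(a)&0\\ B\,\Phi(a)&\Phi(a)\end{pmatrix},\qquad B=TR_{\Phi(a)^{-1}}\big(T\Phi(X_a)\big)\in \mathrm{Lie}(\mathrm{Aut}(V))=\mathrm{End}(V),$$ where $R_g$ is right translation by $g$ in $\mathrm{Aut}(V)$. A representation is called irreducible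 if its only invariant subspaces are $\{0\}$ and the whole space. If $\widetilde\Phi$ is irreducible, then $\Phi$ is irreducible. The converse is not true: the representation $$\Phi:S^1\to\mathrm{Aut}(\mathbb R^2),\qquad \Phi(a,b)(x,y)=(ax+by,\,-bx+ay)$$ is irreducible, but its prolongation $\widetilde\Phi$ is not irreducible. -/

import Mathlib

open scoped Manifold ContDiff

noncomputable section

namespace Prolongation

/-! ### The tangent bundle of a Lie group as a group -/

section TangentGroup

variable {E : Type*} [NormedAddCommGroup E] [NormedSpace ℝ E]
  {H : Type*} [TopologicalSpace H] {I : ModelWithCorners ℝ E H}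

/-- The coordinates of a tangent vector in the model space. -/
def vec {M : Type*} [TopologicalSpace M] [ChartedSpace H M] (X : TangentBundle I M) : E := X.2

theorem tangent_ext {M : Type*} [TopologicalSpace M] [ChartedSpace H M] {X Y : TangentBundle I M}
    (h₁ : X.1 = Y.1) (h₂ : vec X = vec Y) : X = Y := by
  obtain ⟨x, v⟩ := X
  obtain ⟨y, w⟩ := Y
  dsimp at h₁
  subst h₁
  exact congrArg _ h₂

variable {G : Type*} [TopologicalSpace G] [ChartedSpace H G] [Group G] [LieGroup I ∞ G]

/-- The product on `TG` is the tangent map of the product of `G`, through `TG × TG ≅ T(G × G)`. -/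
instance tangentMul : Mul (TangentBundle I G) where
  mul X Y := tangentMap (I.prod I) I (fun q : G × G => q.1 * q.2)
    ((equivTangentBundleProd I G I G).symm (X, Y))

/-- The unit of `TG` is the zero tangent vector at the unit of `G`. -/
instance tangentOne : One (TangentBundle I G) where
  one := ⟨1, 0⟩

/-- The inverse on `TG` is the tangent map of the inverse of `G`. -/
instance tangentInv : Inv (TangentBundle I G) where
  inv X := tangentMap I I (fun a : G => a⁻¹) X

theorem mdiff_mul (p : G × G) :
    MDifferentiableAt (I.prod I) I (fun q : G × G => q.1 * q.2) p :=
  (contMDiff_mul I ∞).mdifferentiable (by simp) p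

theorem mdiff_mul_left (a x : G) : MDifferentiableAt I I (fun z : G => a * z) x :=
  (contMDiff_mul_left (I := I) (n := ∞)).mdifferentiable (by simp) x

theorem mdiff_mul_right (a x : G) : MDifferentiableAt I I (fun z : G => z * a) x :=
  (contMDiff_mul_right (I := I) (n := ∞)).mdifferentiable (by simp) x

theorem mdiff_inv (x : G) : MDifferentiableAt I I (fun z : G => z⁻¹) x :=
  (contMDiff_inv I ∞).mdifferentiable (by simp) x

/-- The derivative of a left translation, seen on the model space. -/
def dL (I : ModelWithCorners ℝ E H) (a x : G) : E →L[ℝ] E := mfderiv I I (fun z : G => a * z) x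

/-- The derivative of a right translation, seen on the model space. -/
def dR (I : ModelWithCorners ℝ E H) (a x : G) : E →L[ℝ] E := mfderiv I I (fun z : G => z * a) x

theorem mul_fst (X Y : TangentBundle I G) : (X * Y).1 = X.1 * Y.1 := rfl

theorem mul_snd (X Y : TangentBundle I G) :
    vec (X * Y) = dR I Y.1 X.1 (vec X) + dL I X.1 Y.1 (vec Y) :=
  mfderiv_prod_eq_add_apply (v := ((X.2, Y.2) : E × E)) (mdiff_mul (I := I) (X.1, Y.1))

theorem dL_mul (a b x : G) (v : E) : dL I (a * b) x v = dL I a (b * x) (dL I b x v) := by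
  have h := mfderiv_comp (I := I) (I' := I) (I'' := I) x (mdiff_mul_left (I := I) a (b * x))
    (mdiff_mul_left (I := I) b x)
  have e : (fun z : G => a * z) ∘ (fun z : G => b * z) = fun z => a * b * z := by
    funext z; simp [mul_assoc]
  have h' := (mfderiv_congr (I := I) (I' := I) (x := x) e).symm.trans h
  exact congrArg (fun L : E →L[ℝ] E => L v) h'

theorem dR_mul (a b x : G) (v : E) : dR I (a * b) x v = dR I b (x * a) (dR I a x v) := by
  have h := mfderiv_comp (I := I) (I' := I) (I'' := I) x (mdiff_mul_right (I := I) b (x * a))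
    (mdiff_mul_right (I := I) a x)
  have e : (fun z : G => z * b) ∘ (fun z : G => z * a) = fun z => z * (a * b) := by
    funext z; simp [mul_assoc]
  have h' := (mfderiv_congr (I := I) (I' := I) (x := x) e).symm.trans h
  exact congrArg (fun L : E →L[ℝ] E => L v) h'

theorem dL_dR (a b x : G) (v : E) : dL I a (x * b) (dR I b x v) = dR I b (a * x) (dL I a x v) := by
  have h₁ := mfderiv_comp (I := I) (I' := I) (I'' := I) x (mdiff_mul_left (I := I) a (x * b))
    (mdiff_mul_right (I := I) b x)
  have h₂ := mfderiv_comp (I := I) (I' := I) (I'' := I) x (mdiff_mul_right (I := I) b (a * x))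
    (mdiff_mul_left (I := I) a x)
  have e : (fun z : G => a * z) ∘ (fun z : G => z * b)
      = (fun z : G => z * b) ∘ (fun z : G => a * z) := by
    funext z; simp [mul_assoc]
  have h' := h₁.symm.trans ((mfderiv_congr (I := I) (I' := I) (x := x) e).trans h₂)
  exact congrArg (fun L : E →L[ℝ] E => L v) h'

theorem dL_one (x : G) (v : E) : dL I 1 x v = v := by
  have e : (fun z : G => 1 * z) = id := by funext z; simp
  have h := (mfderiv_congr (I := I) (I' := I) (x := x) e).trans (mfderiv_id (I := I))
  exact congrArg (fun L : E →L[ℝ] E => L v) h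

theorem dR_one (x : G) (v : E) : dR I 1 x v = v := by
  have e : (fun z : G => z * 1) = id := by funext z; simp
  have h := (mfderiv_congr (I := I) (I' := I) (x := x) e).trans (mfderiv_id (I := I))
  exact congrArg (fun L : E →L[ℝ] E => L v) h

theorem inv_mul_snd (X : TangentBundle I G) : vec (X⁻¹ * X) = 0 := by
  have h₁ := mfderiv_comp (I := I) (I' := I.prod I) (I'' := I) X.1
    (f := fun z : G => (z⁻¹, id z)) (mdiff_mul (I := I) (X.1⁻¹, X.1)) ((mdiff_inv (I := I) X.1).prodMk mdifferentiableAt_id)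
  have e : (fun q : G × G => q.1 * q.2) ∘ (fun z : G => (z⁻¹, id z)) = fun _ => 1 := by
    funext z; simp
  have h₂ := h₁.symm.trans ((mfderiv_congr (I := I) (I' := I) (x := X.1) e).trans
    (mfderiv_const (I := I) (I' := I)))
  have h₃ := congrArg (fun L : E →L[ℝ] E => L X.2) h₂
  have h₄ := mfderiv_prodMk (I := I) (I' := I) (I'' := I) (mdiff_inv (I := I) X.1)
    (mdifferentiableAt_id (I := I) (x := X.1))
  rw [mfderiv_id] at h₄
  rw [h₄] at h₃
  exact h₃

/-- The tangent bundle of a Lie group is a group. -/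
instance tangentGroup : Group (TangentBundle I G) :=
  Group.ofLeftAxioms
    (fun X Y Z => by
      refine tangent_ext (mul_assoc X.1 Y.1 Z.1) ?_
      rw [mul_snd, mul_snd X (Y * Z), mul_snd, mul_snd, mul_fst, mul_fst Y Z, map_add, map_add,
        dR_mul, dL_mul, dL_dR, add_assoc])
    (fun X => by
      refine tangent_ext (one_mul X.1) ?_
      rw [mul_snd]
      change dR I X.1 1 (0 : E) + dL I 1 X.1 (vec X) = _
      rw [map_zero, zero_add, dL_one])
    (fun X => tangent_ext (inv_mul_cancel X.1) (inv_mul_snd X))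

end TangentGroup

/-! ### The tangent bundle of a vector space as a vector space -/

section TangentVectorSpace

variable {V : Type*} [NormedAddCommGroup V] [NormedSpace ℝ V]

/-- For `X ∈ T_x V` and `Y ∈ T_y V`, the sum is `(Tτ_y) X + (Tτ_x) Y ∈ T_{x+y} V`,
where `τ` denotes translations. -/
instance tangentAdd : Add (TangentBundle 𝓘(ℝ, V) V) where
  add X Y := ⟨X.1 + Y.1,
    vec (tangentMap 𝓘(ℝ, V) 𝓘(ℝ, V) (fun p : V => p + Y.1) X) +
      vec (tangentMap 𝓘(ℝ, V) 𝓘(ℝ, V) (fun p : V => X.1 + p) Y)⟩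

/-- `c • X = (Tσ_c) X`, where `σ_c` is the multiplication by the scalar `c`. -/
instance tangentSMul : SMul ℝ (TangentBundle 𝓘(ℝ, V) V) where
  smul c X := tangentMap 𝓘(ℝ, V) 𝓘(ℝ, V) (fun p : V => c • p) X

/-- The trivialization of `TV`, as a bijection. -/
def trivEquiv (V : Type*) [NormedAddCommGroup V] [NormedSpace ℝ V] :
    TangentBundle 𝓘(ℝ, V) V ≃ V × V where
  toFun X := (X.1, vec X)
  invFun q := ⟨q.1, q.2⟩
  left_inv _ := rfl
  right_inv _ := rfl

theorem trivEquiv_add (X Y : TangentBundle 𝓘(ℝ, V) V) :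
    trivEquiv V (X + Y) = trivEquiv V X + trivEquiv V Y := by
  have h₁ : mfderiv 𝓘(ℝ, V) 𝓘(ℝ, V) (fun p : V => p + Y.1) X.1 = ContinuousLinearMap.id ℝ V := by
    rw [mfderiv_eq_fderiv, fderiv_add_const]; exact fderiv_id
  have h₂ : mfderiv 𝓘(ℝ, V) 𝓘(ℝ, V) (fun p : V => X.1 + p) Y.1 = ContinuousLinearMap.id ℝ V := by
    rw [mfderiv_eq_fderiv, fderiv_const_add]; exact fderiv_id
  refine Prod.ext rfl ?_
  exact congrArg₂ (fun a b : V => a + b) (congrArg (fun L : V →L[ℝ] V => L X.2) h₁)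
    (congrArg (fun L : V →L[ℝ] V => L Y.2) h₂)

theorem trivEquiv_smul (c : ℝ) (X : TangentBundle 𝓘(ℝ, V) V) :
    trivEquiv V (c • X) = c • trivEquiv V X := by
  have h : mfderiv 𝓘(ℝ, V) 𝓘(ℝ, V) (fun p : V => c • p) X.1 = c • ContinuousLinearMap.id ℝ V := by
    rw [mfderiv_eq_fderiv, fderiv_fun_const_smul differentiableAt_fun_id]
    exact congrArg _ fderiv_id
  refine Prod.ext rfl ?_
  exact congrArg (fun L : V →L[ℝ] V => L X.2) h

instance tangentZero : Zero (TangentBundle 𝓘(ℝ, V) V) := ⟨⟨0, 0⟩⟩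

instance tangentNeg : Neg (TangentBundle 𝓘(ℝ, V) V) := ⟨fun X => (-1 : ℝ) • X⟩

theorem trivEquiv_neg (X : TangentBundle 𝓘(ℝ, V) V) : trivEquiv V (-X) = -trivEquiv V X := by
  refine (trivEquiv_smul (-1) X).trans ?_
  simp

instance tangentAddCommGroup : AddCommGroup (TangentBundle 𝓘(ℝ, V) V) :=
  { AddGroup.ofLeftAxioms
      (fun X Y Z => (trivEquiv V).injective (by simp only [trivEquiv_add, add_assoc]))
      (fun X => (trivEquiv V).injective (by
        rw [trivEquiv_add]; exact zero_add (trivEquiv V X)))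
      (fun X => (trivEquiv V).injective (by
        rw [trivEquiv_add, trivEquiv_neg, neg_add_cancel]; rfl)) with
    add_comm := fun X Y => (trivEquiv V).injective (by
      rw [trivEquiv_add, trivEquiv_add, add_comm]) }

instance tangentModule : Module ℝ (TangentBundle 𝓘(ℝ, V) V) where
  one_smul X := (trivEquiv V).injective (by rw [trivEquiv_smul, one_smul])
  mul_smul a b X := (trivEquiv V).injective (by simp only [trivEquiv_smul, mul_smul])
  smul_zero a := (trivEquiv V).injective (by
    rw [trivEquiv_smul]; exact smul_zero a)
  smul_add a X Y := (trivEquiv V).injective (by simp only [trivEquiv_smul, trivEquiv_add, smul_add])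
  add_smul a b X := (trivEquiv V).injective (by simp only [trivEquiv_smul, trivEquiv_add, add_smul])
  zero_smul X := (trivEquiv V).injective (by
    rw [trivEquiv_smul, zero_smul]; rfl)

/-- The trivialization `ψ : TV → V × V` of the tangent bundle, a linear isomorphism. -/
def triv (V : Type*) [NormedAddCommGroup V] [NormedSpace ℝ V] :
    TangentBundle 𝓘(ℝ, V) V ≃ₗ[ℝ] V × V :=
  { trivEquiv V with
    map_add' := trivEquiv_add
    map_smul' := trivEquiv_smul }

end TangentVectorSpace

/-! ### Representations and their prolongations -/

section Prolong

variable {V : Type*} [NormedAddCommGroup V] [NormedSpace ℝ V] [FiniteDimensional ℝ V]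

/-- The block operator with matrix `(a, 0; B a, a)` on `V × V`. -/
def block (a B : V →L[ℝ] V) : V × V →ₗ[ℝ] V × V where
  toFun q := (a q.1, B (a q.1) + a q.2)
  map_add' q r := by
    ext <;> simp only [Prod.fst_add, Prod.snd_add, map_add]
    abel
  map_smul' c q := by
    ext <;> simp

/-- For `Y ∈ T_a Aut(V)`, the vector `B = (T R_{a⁻¹}) Y ∈ Lie(Aut(V)) = End(V)`, so that
`Y = (T R_a) B = [a, B]`. -/
def rightTriv (Y : TangentBundle 𝓘(ℝ, V →L[ℝ] V) (V →L[ℝ] V)ˣ) : V →L[ℝ] V :=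
  vec (tangentMap 𝓘(ℝ, V →L[ℝ] V) 𝓘(ℝ, V →L[ℝ] V)
    (fun b : (V →L[ℝ] V)ˣ => b * Y.1⁻¹) Y)

/-- The map `J : T(Aut(V)) → End(TV)`, which sends `[a, B]` to the operator with matrix
`(a, 0; B a, a)` in the trivialization `ψ`. -/
def autLift (Y : TangentBundle 𝓘(ℝ, V →L[ℝ] V) (V →L[ℝ] V)ˣ) :
    Module.End ℝ (TangentBundle 𝓘(ℝ, V) V) :=
  (triv V).symm.toLinearMap ∘ₗ block (Y.1 : V →L[ℝ] V) (rightTriv Y) ∘ₗ (triv V).toLinearMap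

theorem mfderiv_unitsVal (a : (V →L[ℝ] V)ˣ) :
    HasMFDerivAt 𝓘(ℝ, V →L[ℝ] V) 𝓘(ℝ, V →L[ℝ] V)
      (Units.val : (V →L[ℝ] V)ˣ → (V →L[ℝ] V)) a
      (ContinuousLinearMap.id ℝ (V →L[ℝ] V)) := by
  refine ⟨Units.continuous_val.continuousAt, ?_⟩
  refine (hasFDerivWithinAt_id _ _).congr_of_eventuallyEq ?_ ?_
  · have h := extChartAt_target_mem_nhdsWithin (I := 𝓘(ℝ, V →L[ℝ] V)) a
    filter_upwards [h] with z hz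
    exact (extChartAt 𝓘(ℝ, V →L[ℝ] V) a).right_inv hz
  · exact (extChartAt 𝓘(ℝ, V →L[ℝ] V) a).right_inv
      ((extChartAt 𝓘(ℝ, V →L[ℝ] V) a).map_source (mem_extChartAt_source a))

variable {E : Type*} [NormedAddCommGroup E] [NormedSpace ℝ E]
  {H : Type*} [TopologicalSpace H] {I : ModelWithCorners ℝ E H}

theorem mfderiv_val_comp {M : Type*} [TopologicalSpace M] [ChartedSpace H M]
    {f : M → (V →L[ℝ] V)ˣ} {x : M} (hf : MDifferentiableAt I 𝓘(ℝ, V →L[ℝ] V) f x) (v : E) :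
    @Eq (V →L[ℝ] V) ((mfderiv I 𝓘(ℝ, V →L[ℝ] V) f x : E →L[ℝ] (V →L[ℝ] V)) v)
      ((mfderiv I 𝓘(ℝ, V →L[ℝ] V) (fun y => (f y : V →L[ℝ] V)) x : E →L[ℝ] (V →L[ℝ] V)) v) := by
  have h := (HasMFDerivAt.comp x (mfderiv_unitsVal (f x)) hf.hasMFDerivAt).mfderiv
  exact (congrArg (fun L : E →L[ℝ] (V →L[ℝ] V) => L v) h).symm

theorem dR_units (a x : (V →L[ℝ] V)ˣ) (B : V →L[ℝ] V) :
    dR 𝓘(ℝ, V →L[ℝ] V) a x B = B * (a : V →L[ℝ] V) := by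
  refine (mfderiv_val_comp (mdiff_mul_right (I := 𝓘(ℝ, V →L[ℝ] V)) a x) B).trans ?_
  have h : HasMFDerivAt 𝓘(ℝ, V →L[ℝ] V) 𝓘(ℝ, V →L[ℝ] V)
      (fun T : V →L[ℝ] V => T * (a : V →L[ℝ] V)) (x : V →L[ℝ] V)
      ((ContinuousLinearMap.mul ℝ (V →L[ℝ] V)).flip (a : V →L[ℝ] V)) :=
    (((ContinuousLinearMap.mul ℝ (V →L[ℝ] V)).flip (a : V →L[ℝ] V)).hasFDerivAt).hasMFDerivAt
  have h' := (HasMFDerivAt.comp x h (mfderiv_unitsVal x)).mfderiv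
  exact congrArg (fun L : (V →L[ℝ] V) →L[ℝ] (V →L[ℝ] V) => L B) h'

theorem dL_units (a x : (V →L[ℝ] V)ˣ) (B : V →L[ℝ] V) :
    dL 𝓘(ℝ, V →L[ℝ] V) a x B = (a : V →L[ℝ] V) * B := by
  refine (mfderiv_val_comp (mdiff_mul_left (I := 𝓘(ℝ, V →L[ℝ] V)) a x) B).trans ?_
  have h : HasMFDerivAt 𝓘(ℝ, V →L[ℝ] V) 𝓘(ℝ, V →L[ℝ] V)
      (fun T : V →L[ℝ] V => (a : V →L[ℝ] V) * T) (x : V →L[ℝ] V)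
      ((ContinuousLinearMap.mul ℝ (V →L[ℝ] V)) (a : V →L[ℝ] V)) :=
    (((ContinuousLinearMap.mul ℝ (V →L[ℝ] V)) (a : V →L[ℝ] V)).hasFDerivAt).hasMFDerivAt
  have h' := (HasMFDerivAt.comp x h (mfderiv_unitsVal x)).mfderiv
  exact congrArg (fun L : (V →L[ℝ] V) →L[ℝ] (V →L[ℝ] V) => L B) h'

theorem rightTriv_eq (Y : TangentBundle 𝓘(ℝ, V →L[ℝ] V) (V →L[ℝ] V)ˣ) :
    rightTriv Y = vec Y * ((Y.1⁻¹ : (V →L[ℝ] V)ˣ) : V →L[ℝ] V) :=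
  dR_units Y.1⁻¹ Y.1 (vec Y)

theorem rightTriv_mul (Y : TangentBundle 𝓘(ℝ, V →L[ℝ] V) (V →L[ℝ] V)ˣ) (p : V) :
    rightTriv Y ((Y.1 : V →L[ℝ] V) p) = vec Y p := by
  rw [rightTriv_eq]
  change vec Y ((((Y.1⁻¹ : (V →L[ℝ] V)ˣ) : V →L[ℝ] V) * (Y.1 : V →L[ℝ] V)) p) = _
  rw [Units.inv_mul]
  rfl

theorem autLift_apply (Y : TangentBundle 𝓘(ℝ, V →L[ℝ] V) (V →L[ℝ] V)ˣ)
    (W : TangentBundle 𝓘(ℝ, V) V) :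
    triv V (autLift Y W) = ((Y.1 : V →L[ℝ] V) W.1,
      vec Y W.1 + (Y.1 : V →L[ℝ] V) (vec W)) := by
  refine Prod.ext rfl ?_
  exact congrArg (fun v : V => v + (Y.1 : V →L[ℝ] V) (vec W)) (rightTriv_mul Y W.1)

/-- `J` is a homomorphism for the group structure of `T(Aut(V))`. -/
def autLiftHom : TangentBundle 𝓘(ℝ, V →L[ℝ] V) (V →L[ℝ] V)ˣ →*
    Module.End ℝ (TangentBundle 𝓘(ℝ, V) V) where
  toFun := autLift
  map_one' := by
    refine LinearMap.ext fun W => (triv V).injective ?_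
    rw [autLift_apply]
    refine Prod.ext rfl ?_
    exact zero_add (vec W)
  map_mul' X Y := by
    refine LinearMap.ext fun W => (triv V).injective ?_
    rw [Module.End.mul_apply, autLift_apply, autLift_apply]
    have h := autLift_apply Y W
    have h₁ : (autLift Y W).1 = (Y.1 : V →L[ℝ] V) W.1 := congrArg Prod.fst h
    have h₂ : vec (autLift Y W) = vec Y W.1 + (Y.1 : V →L[ℝ] V) (vec W) :=
      congrArg Prod.snd h
    rw [h₁, h₂, mul_snd, dR_units, dL_units, mul_fst, map_add]
    refine Prod.ext rfl ?_
    exact add_assoc (vec X ((Y.1 : V →L[ℝ] V) W.1)) _ _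

variable {G : Type*} [TopologicalSpace G] [ChartedSpace H G] [Group G] [LieGroup I ∞ G]

/-- The tangent map of a homomorphism of Lie groups `G → Aut(V)` is a homomorphism. -/
def tangentHom (Φ : ContMDiffMonoidMorphism I 𝓘(ℝ, V →L[ℝ] V) ∞ G (V →L[ℝ] V)ˣ) :
    TangentBundle I G →* TangentBundle 𝓘(ℝ, V →L[ℝ] V) (V →L[ℝ] V)ˣ where
  toFun := tangentMap I 𝓘(ℝ, V →L[ℝ] V) (Φ : G → (V →L[ℝ] V)ˣ)
  map_one' := tangent_ext (map_one Φ.toMonoidHom)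
    (map_zero (mfderiv I 𝓘(ℝ, V →L[ℝ] V) (Φ : G → (V →L[ℝ] V)ˣ) 1))
  map_mul' X Y := by
    have hΦ : ∀ x, MDifferentiableAt I 𝓘(ℝ, V →L[ℝ] V) (Φ : G → (V →L[ℝ] V)ˣ) x := fun x =>
      Φ.contMDiff_toFun.mdifferentiable (by simp) x
    refine tangent_ext (map_mul Φ.toMonoidHom X.1 Y.1) ?_
    rw [mul_snd]
    let D : G → E →L[ℝ] (V →L[ℝ] V) := fun x => mfderiv I 𝓘(ℝ, V →L[ℝ] V) (Φ : G → (V →L[ℝ] V)ˣ) x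
    change D (X.1 * Y.1) (vec (X * Y)) =
      dR 𝓘(ℝ, V →L[ℝ] V) (Φ Y.1) (Φ X.1) (D X.1 (vec X)) +
      dL 𝓘(ℝ, V →L[ℝ] V) (Φ X.1) (Φ Y.1) (D Y.1 (vec Y))
    rw [mul_snd, map_add]
    congr 1
    · have h₁ := mfderiv_comp (I := I) (I' := I) (I'' := 𝓘(ℝ, V →L[ℝ] V)) X.1
        (hΦ (X.1 * Y.1)) (mdiff_mul_right (I := I) Y.1 X.1)
      have h₂ := mfderiv_comp (I := I) (I' := 𝓘(ℝ, V →L[ℝ] V)) (I'' := 𝓘(ℝ, V →L[ℝ] V)) X.1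
        (mdiff_mul_right (I := 𝓘(ℝ, V →L[ℝ] V)) (Φ Y.1) (Φ X.1)) (hΦ X.1)
      have e : (Φ : G → (V →L[ℝ] V)ˣ) ∘ (fun z : G => z * Y.1)
          = (fun b : (V →L[ℝ] V)ˣ => b * Φ Y.1) ∘ (Φ : G → (V →L[ℝ] V)ˣ) := by
        funext z; exact map_mul Φ.toMonoidHom z Y.1
      have h := h₁.symm.trans ((mfderiv_congr (I := I) (I' := 𝓘(ℝ, V →L[ℝ] V)) (x := X.1) e).trans h₂)
      exact congrArg (fun L : E →L[ℝ] (V →L[ℝ] V) => L X.2) h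
    · have h₁ := mfderiv_comp (I := I) (I' := I) (I'' := 𝓘(ℝ, V →L[ℝ] V)) Y.1
        (hΦ (X.1 * Y.1)) (mdiff_mul_left (I := I) X.1 Y.1)
      have h₂ := mfderiv_comp (I := I) (I' := 𝓘(ℝ, V →L[ℝ] V)) (I'' := 𝓘(ℝ, V →L[ℝ] V)) Y.1
        (mdiff_mul_left (I := 𝓘(ℝ, V →L[ℝ] V)) (Φ X.1) (Φ Y.1)) (hΦ Y.1)
      have e : (Φ : G → (V →L[ℝ] V)ˣ) ∘ (fun z : G => X.1 * z)
          = (fun b : (V →L[ℝ] V)ˣ => Φ X.1 * b) ∘ (Φ : G → (V →L[ℝ] V)ˣ) := by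
        funext z; exact map_mul Φ.toMonoidHom X.1 z
      have h := h₁.symm.trans ((mfderiv_congr (I := I) (I' := 𝓘(ℝ, V →L[ℝ] V)) (x := Y.1) e).trans h₂)
      exact congrArg (fun L : E →L[ℝ] (V →L[ℝ] V) => L Y.2) h

/-- A Lie group homomorphism `Φ : G → Aut(V)`, as a representation of `G` on `V`. -/
def toRep (Φ : ContMDiffMonoidMorphism I 𝓘(ℝ, V →L[ℝ] V) ∞ G (V →L[ℝ] V)ˣ) :
    Representation ℝ G V where
  toFun a := ((Φ a : (V →L[ℝ] V)ˣ) : V →L[ℝ] V).toLinearMap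
  map_one' := by
    rw [show Φ 1 = 1 from map_one Φ.toMonoidHom]; rfl
  map_mul' a b := by
    rw [show Φ (a * b) = Φ a * Φ b from map_mul Φ.toMonoidHom a b]; rfl

/-- The prolongation `J ∘ TΦ : TG → Aut(TV)` of `Φ : G → Aut(V)`, as a representation of the
group `TG` on the vector space `TV`. -/
def prolongation (Φ : ContMDiffMonoidMorphism I 𝓘(ℝ, V →L[ℝ] V) ∞ G (V →L[ℝ] V)ˣ) :
    Representation ℝ (TangentBundle I G) (TangentBundle 𝓘(ℝ, V) V) :=
  autLiftHom.comp (tangentHom Φ)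

end Prolong

/-- A representation is irreducible if its only invariant subspaces are `0` and the whole space. -/
def Irred {G W : Type*} [Group G] [AddCommGroup W] [Module ℝ W] (ρ : Representation ℝ G W) : Prop :=
  ∀ U : Submodule ℝ W, (∀ g : G, ∀ v ∈ U, ρ g v ∈ U) → U = ⊥ ∨ U = ⊤

/-- On nonzero spaces this is irreducibility in the sense of Mathlib. -/
theorem irred_iff {G W : Type*} [Group G] [AddCommGroup W] [Module ℝ W] [Nontrivial W]
    (ρ : Representation ℝ G W) : Irred ρ ↔ ρ.IsIrreducible := by
  constructor
  · intro h
    have : Nontrivial (Subrepresentation ρ) := ⟨⟨⊥, ⊤, fun e =>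
      bot_ne_top (α := Submodule ℝ W) (congrArg Subrepresentation.toSubmodule e)⟩⟩
    exact ⟨fun U => (h U.toSubmodule U.apply_mem_toSubmodule).imp
      (fun e => Subrepresentation.toSubmodule_injective e)
      (fun e => Subrepresentation.toSubmodule_injective e)⟩
  · intro h U hU
    exact (h.eq_bot_or_eq_top ⟨U, hU⟩).imp (congrArg Subrepresentation.toSubmodule)
      (congrArg Subrepresentation.toSubmodule)

/-! ### The rotation representation of the circle -/

/-- The operator `(x, y) ↦ (a x + b y, -b x + a y)` on `ℝ²`, for `z = a + i b`. -/
def rotCLM (z : ℂ) : ℝ × ℝ →L[ℝ] ℝ × ℝ :=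
  (z.re • ContinuousLinearMap.fst ℝ ℝ ℝ + z.im • ContinuousLinearMap.snd ℝ ℝ ℝ).prod
    (-z.im • ContinuousLinearMap.fst ℝ ℝ ℝ + z.re • ContinuousLinearMap.snd ℝ ℝ ℝ)

theorem rotCLM_apply (z : ℂ) (p : ℝ × ℝ) :
    rotCLM z p = (z.re * p.1 + z.im * p.2, -z.im * p.1 + z.re * p.2) := rfl

theorem rotCLM_one : rotCLM 1 = 1 := by
  refine ContinuousLinearMap.ext fun p => ?_
  rw [rotCLM_apply]
  simp

theorem rotCLM_mul (z w : ℂ) : rotCLM (z * w) = rotCLM z * rotCLM w := by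
  refine ContinuousLinearMap.ext fun p => ?_
  rw [mul_apply_eq_comp, rotCLM_apply, rotCLM_apply, rotCLM_apply]
  ext <;> simp <;> ring

/-- `Φ : S¹ → Aut(ℝ²)`, `Φ(a, b)(x, y) = (a x + b y, -b x + a y)`. -/
def rotation : ContMDiffMonoidMorphism (𝓡 1) 𝓘(ℝ, ℝ × ℝ →L[ℝ] ℝ × ℝ) ∞ Circle
    (ℝ × ℝ →L[ℝ] ℝ × ℝ)ˣ where
  toFun z := ⟨rotCLM z, rotCLM (z⁻¹ : Circle),
    by rw [← rotCLM_mul, ← Circle.coe_mul, mul_inv_cancel, Circle.coe_one, rotCLM_one],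
    by rw [← rotCLM_mul, ← Circle.coe_mul, inv_mul_cancel, Circle.coe_one, rotCLM_one]⟩
  map_one' := Units.ext (by simp [rotCLM_one])
  map_mul' z w := Units.ext (by simp [rotCLM_mul])
  contMDiff_toFun := by
    apply ContMDiff.of_comp_isOpenEmbedding Units.isOpenEmbedding_val
    have h : ContMDiff 𝓘(ℝ, ℂ) 𝓘(ℝ, ℝ × ℝ →L[ℝ] ℝ × ℝ) ∞ rotCLM := by
      rw [contMDiff_iff_contDiff]
      let L : ℂ →ₗ[ℝ] (ℝ × ℝ →L[ℝ] ℝ × ℝ) :=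
        { toFun := rotCLM
          map_add' := fun z w => by
            refine ContinuousLinearMap.ext fun p => ?_
            rw [_root_.add_apply, rotCLM_apply, rotCLM_apply, rotCLM_apply]
            ext <;> simp <;> ring
          map_smul' := fun c z => by
            refine ContinuousLinearMap.ext fun p => ?_
            rw [_root_.smul_apply, rotCLM_apply, rotCLM_apply]
            ext <;> simp <;> ring }
      exact L.toContinuousLinearMap.contDiff
    have := finrank_real_complex_fact'
    exact h.comp (contMDiff_coe_sphere (E := ℂ) (n := 1))

end Prolongation

end

/-!
For a subspace `U₂ ⊇ U₁` of `V`, consider the tangent vectors at points of `U₁` whose coordinates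
lie in `U₂`. If `U₁` and `U₂` are invariant under `Φ`, these vectors form an invariant subspace of
`TV`: for `w ∈ U₁` the map `g ↦ Φ(g) w` takes values in `U₁`, which is closed, hence so does its
derivative, and the lower left block of `Φ̃` maps `U₁` into `U₁ ⊆ U₂`.

With `U₁ = U₂ = U` this is `TU`, so a proper nonzero invariant subspace of `V` gives one of `TV`.
With `U₁ = 0` and `U₂ = V` it is `T₀V`, which shows that no prolongation on a nonzero space is
irreducible. The rotations of the plane are irreducible because the quarter turn `J` has no real
eigenvalue, as `J² = -1`.
-/

namespace Prolongation

open scoped Topology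

section Derivative

variable {𝕜 : Type*} [NontriviallyNormedField 𝕜]
  {E : Type*} [NormedAddCommGroup E] [NormedSpace 𝕜 E]
  {H : Type*} [TopologicalSpace H] {I : ModelWithCorners 𝕜 E H}
  {M : Type*} [TopologicalSpace M] [ChartedSpace H M]
  {F : Type*} [NormedAddCommGroup F] [NormedSpace 𝕜 F]

theorem hasMFDerivAt_apply_mem_of_eventually_mem {f : M → F} {x : M}
    {f' : TangentSpace I x →L[𝕜] F} (hf : HasMFDerivAt I 𝓘(𝕜, F) f x f') {U : Submodule 𝕜 F}
    (hU : IsClosed (U : Set F)) (hfU : ∀ᶠ y in 𝓝 x, f y ∈ U) (v : TangentSpace I x) :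
    f' v ∈ U := by
  have : IsClosed (U : Set F) := hU
  have h_comp : HasMFDerivAt I 𝓘(𝕜, F ⧸ U) (U.mkQL ∘ f) x (U.mkQL ∘L f') :=
    HasMFDerivAt.comp x U.mkQL.hasFDerivAt.hasMFDerivAt hf
  have h_zero : HasMFDerivAt I 𝓘(𝕜, F ⧸ U) (U.mkQL ∘ f) x (0 : TangentSpace I x →L[𝕜] F ⧸ U) :=
    (hasMFDerivAt_const 0 x).congr_of_eventuallyEq <|
      hfU.mono fun _ hy => (Submodule.Quotient.mk_eq_zero U).2 hy
  have h_eq : U.mkQL ∘L f' = 0 := hasMFDerivAt_unique h_comp h_zero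
  exact (Submodule.Quotient.mk_eq_zero U).1 (DFunLike.congr_fun h_eq v)

end Derivative

section TangentProd

variable {V : Type*} [NormedAddCommGroup V] [NormedSpace ℝ V] {U₁ U₂ : Submodule ℝ V}

/-- The subspace of `TV` that the trivialization `ψ` identifies with `U₁ × U₂`: the tangent vectors
at points of `U₁` with coordinates in `U₂`. The tangent bundle `TU` of a subspace is
`tangentProd U U`, and the tangent space `T₀V` is `tangentProd ⊥ ⊤`. -/
noncomputable def tangentProd (U₁ U₂ : Submodule ℝ V) :
    Submodule ℝ (TangentBundle 𝓘(ℝ, V) V) :=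
  (Submodule.orderIsoMapComap (triv V)).symm (U₁.prod U₂)

theorem mem_tangentProd {W : TangentBundle 𝓘(ℝ, V) V} :
    W ∈ tangentProd U₁ U₂ ↔ (triv V W).1 ∈ U₁ ∧ (triv V W).2 ∈ U₂ :=
  Iff.rfl

theorem tangentProd_eq_bot_iff : tangentProd U₁ U₂ = ⊥ ↔ U₁ = ⊥ ∧ U₂ = ⊥ :=
  (map_eq_bot_iff _).trans (Submodule.prod_eq_bot_iff ..)

theorem tangentProd_eq_top_iff : tangentProd U₁ U₂ = ⊤ ↔ U₁ = ⊤ ∧ U₂ = ⊤ :=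
  (map_eq_top_iff _).trans (Submodule.prod_eq_top_iff ..)

end TangentProd

theorem irred_iff_forall_mem_invtSubmodule {G W : Type*} [Group G] [AddCommGroup W] [Module ℝ W]
    {ρ : Representation ℝ G W} : Irred ρ ↔ ∀ U ∈ ρ.invtSubmodule, U = ⊥ ∨ U = ⊤ := by
  simp only [Representation.mem_invtSubmodule,
    Module.End.mem_invtSubmodule_iff_forall_mem_of_mem, Irred]

section InvariantSubspaces

variable {V : Type*} [NormedAddCommGroup V] [NormedSpace ℝ V] [FiniteDimensional ℝ V]
  {E : Type*} [NormedAddCommGroup E] [NormedSpace ℝ E]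
  {H : Type*} [TopologicalSpace H] {I : ModelWithCorners ℝ E H}

theorem vec_tangentMap_apply_mem {M : Type*} [TopologicalSpace M] [ChartedSpace H M]
    {f : M → (V →L[ℝ] V)ˣ} {X : TangentBundle I M}
    (hf : MDifferentiableAt I 𝓘(ℝ, V →L[ℝ] V) f X.1) {U : Submodule ℝ V} {w : V}
    (hU : ∀ᶠ y in 𝓝 X.1, (f y : V →L[ℝ] V) w ∈ U) :
    vec (tangentMap I 𝓘(ℝ, V →L[ℝ] V) f X) w ∈ U :=
  hasMFDerivAt_apply_mem_of_eventually_mem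
    (U := U.comap (ContinuousLinearMap.apply ℝ V w).toLinearMap)
    (HasMFDerivAt.comp X.1 (mfderiv_unitsVal (f X.1)) hf.hasMFDerivAt)
    (Submodule.closed_of_finiteDimensional _) hU X.2

variable {G : Type*} [TopologicalSpace G] [ChartedSpace H G] [Group G] [LieGroup I ∞ G]
  (Φ : ContMDiffMonoidMorphism I 𝓘(ℝ, V →L[ℝ] V) ∞ G (V →L[ℝ] V)ˣ)

theorem triv_prolongation_apply (X : TangentBundle I G) (W : TangentBundle 𝓘(ℝ, V) V) :
    triv V (prolongation Φ X W) =
      (toRep Φ X.1 (triv V W).1,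
        vec (tangentMap I 𝓘(ℝ, V →L[ℝ] V) Φ X) (triv V W).1 + toRep Φ X.1 (triv V W).2) :=
  autLift_apply (tangentMap I 𝓘(ℝ, V →L[ℝ] V) Φ X) W

variable {Φ} {U₁ U₂ : Submodule ℝ V}

theorem tangentProd_mem_invtSubmodule (h₁ : U₁ ∈ (toRep Φ).invtSubmodule)
    (h₂ : U₂ ∈ (toRep Φ).invtSubmodule) (h : U₁ ≤ U₂) :
    tangentProd U₁ U₂ ∈ (prolongation Φ).invtSubmodule := by
  rw [Representation.mem_invtSubmodule] at h₁ h₂ ⊢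
  intro X W hW
  obtain ⟨h_base, h_coord⟩ := mem_tangentProd.1 hW
  have hΦ : MDifferentiableAt I 𝓘(ℝ, V →L[ℝ] V) Φ X.1 :=
    Φ.contMDiff_toFun.mdifferentiable (by simp) X.1
  have h_deriv : vec (tangentMap I 𝓘(ℝ, V →L[ℝ] V) Φ X) (triv V W).1 ∈ U₁ :=
    vec_tangentMap_apply_mem hΦ (.of_forall fun g => h₁ g h_base)
  rw [Submodule.mem_comap, mem_tangentProd, triv_prolongation_apply]
  exact ⟨h₁ X.1 h_base, U₂.add_mem (h h_deriv) (h₂ X.1 h_coord)⟩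

theorem irred_toRep_of_irred_prolongation (h : Irred (prolongation Φ)) : Irred (toRep Φ) := by
  rw [irred_iff_forall_mem_invtSubmodule] at h ⊢
  intro U hU
  exact (h (tangentProd U U) (tangentProd_mem_invtSubmodule hU hU le_rfl)).imp
    (fun h_bot => (tangentProd_eq_bot_iff.1 h_bot).1)
    (fun h_top => (tangentProd_eq_top_iff.1 h_top).1)

variable (Φ) in
theorem not_irred_prolongation [Nontrivial V] : ¬ Irred (prolongation Φ) := by
  rw [irred_iff_forall_mem_invtSubmodule]
  intro h
  have h_vertical : tangentProd ⊥ ⊤ ∈ (prolongation Φ).invtSubmodule :=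
    tangentProd_mem_invtSubmodule (Representation.invtSubmodule.bot_mem _)
      (Representation.invtSubmodule.top_mem _) bot_le
  rcases h _ h_vertical with h_bot | h_top
  · exact top_ne_bot (tangentProd_eq_bot_iff.1 h_bot).2
  · exact bot_ne_top (tangentProd_eq_top_iff.1 h_top).1

end InvariantSubspaces

section Plane

variable {K V : Type*} [Field K] [AddCommGroup V] [Module K V] {f : Module.End K V}

theorem not_hasEigenvalue_of_mul_self_eq_neg_one (hK : ¬ IsSquare (-1 : K)) (hf : f * f = -1)
    (μ : K) : ¬ f.HasEigenvalue μ := by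
  intro hμ
  obtain ⟨v, hv⟩ := hμ.exists_hasEigenvector
  have h_sq : (μ * μ) • v = (-1 : K) • v :=
    calc (μ * μ) • v = (f * f) v := by
          rw [Module.End.mul_apply, hv.apply_eq_smul, map_smul, hv.apply_eq_smul, mul_smul]
      _ = (-1 : K) • v := by rw [hf, neg_one_smul]; rfl
  exact hK ⟨μ, (smul_left_injective K hv.2 h_sq).symm⟩

theorem eq_bot_or_eq_top_of_forall_not_hasEigenvalue (hV : Module.finrank K V = 2)
    (hf : ∀ μ, ¬ f.HasEigenvalue μ) {U : Submodule K V} (hU : U ∈ f.invtSubmodule) :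
    U = ⊥ ∨ U = ⊤ := by
  refine or_iff_not_imp_left.2 fun hU_ne => ?_
  obtain ⟨v, hvU, hv⟩ := U.ne_bot_iff.1 hU_ne
  have h_indep : LinearIndependent K ![v, f v] :=
    (LinearIndependent.pair_iff' hv).2 fun μ hμ =>
      hf μ (Module.End.hasEigenvalue_of_hasEigenvector
        (Module.End.hasEigenvector_iff.2 ⟨Module.End.mem_eigenspace_iff.2 hμ.symm, hv⟩))
  have h_span : Submodule.span K (Set.range ![v, f v]) = ⊤ :=
    h_indep.span_eq_top_of_card_eq_finrank (by rw [hV, Fintype.card_fin])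
  rw [eq_top_iff, ← h_span, Submodule.span_le, Matrix.range_cons_cons_empty, Set.pair_subset_iff]
  exact ⟨hvU, hU hvU⟩

end Plane

theorem irred_toRep_rotation : Irred (toRep rotation) := by
  rw [irred_iff_forall_mem_invtSubmodule]
  intro U hU
  let i : Circle := ⟨Complex.I, mem_sphere_zero_iff_norm.2 Complex.norm_I⟩
  have h_sq : toRep rotation i * toRep rotation i = -1 := by
    refine LinearMap.ext fun p => ?_
    change rotCLM Complex.I (rotCLM Complex.I p) = -p
    ext <;> simp [rotCLM_apply]
  have h_neg_one : ¬ IsSquare (-1 : ℝ) := fun h => by linarith [h.nonneg]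
  exact eq_bot_or_eq_top_of_forall_not_hasEigenvalue (by simp)
    (not_hasEigenvalue_of_mul_self_eq_neg_one h_neg_one h_sq)
    ((toRep rotation).mem_invtSubmodule.1 hU i)

end Prolongation

open Prolongation in
theorem corollary3p10_general
    {E : Type*} [NormedAddCommGroup E] [NormedSpace ℝ E]
    {H : Type*} [TopologicalSpace H] {I : ModelWithCorners ℝ E H}
    {G : Type*} [TopologicalSpace G] [ChartedSpace H G] [Group G] [LieGroup I ∞ G]
    {V : Type*} [NormedAddCommGroup V] [NormedSpace ℝ V] [FiniteDimensional ℝ V]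
    (Φ : ContMDiffMonoidMorphism I 𝓘(ℝ, V →L[ℝ] V) ∞ G (V →L[ℝ] V)ˣ) :
    (Irred (prolongation Φ) → Irred (toRep Φ)) ∧
      (Irred (toRep rotation) ∧ ¬ Irred (prolongation rotation)) :=
  ⟨irred_toRep_of_irred_prolongation, irred_toRep_rotation, not_irred_prolongation rotation⟩

open Prolongation in
theorem corollary3p10
    {E : Type*} [NormedAddCommGroup E] [NormedSpace ℝ E] [FiniteDimensional ℝ E]
    {H : Type*} [TopologicalSpace H] (I : ModelWithCorners ℝ E H)
    {G : Type*} [TopologicalSpace G] [ChartedSpace H G] [Group G] [LieGroup I ∞ G]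
    {V : Type*} [NormedAddCommGroup V] [NormedSpace ℝ V] [FiniteDimensional ℝ V]
    (Φ : ContMDiffMonoidMorphism I 𝓘(ℝ, V →L[ℝ] V) ∞ G (V →L[ℝ] V)ˣ) :
    (Irred (prolongation Φ) → Irred (toRep Φ)) ∧
      (Irred (toRep rotation) ∧ ¬ Irred (prolongation rotation)) :=
  corollary3p10_general Φ
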